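/- Let $d\ge 1$ and $p\in[0,1]$. The quantum erasure channel $\mathcal N=\mathcal N_p^{A'\to B}$ with $|A'|=d$, $|B|=d+1$ transmits its input with probability $1-p$ and replaces it, with probability $p$, by a fixed state $|e\rangle$ orthogonal to the embedded input space; its Kraus operators are $\sqrt{1-p}\sum_{i=1}^d|i\rangle\langle i|$ and $\sqrt p\,|e\rangle\langle i|$, $i=1,\dots,d$. Let $Q(\mathcal N)=\max_{\rho^{AA'}}\left[H(B)_\sigma-H(AB)_\sigma\right]$, $\sigma^{AB}=(\mathrm{id}\otimes\mathcal N)(\rho^{AA'})$, be its coherent information, where the maximum is over all finite-dimensional systems $A$ and all states $\rho^{AA'}$, and $H(\rho)=-\mathrm{Tr}\,\rho\ln\rho$. Consider $n\ge1$ uses of the channel. Let $|\phi\rangle^{AS}$ be a unit vector whose marginal on $S$ is completely mixed, and let $\mathcal R=\frac1n\ln|S|$ be the rate. Let the joint state $\rho^{AA'^n}$ of $A$ and the $n$ channel inputs be a pure maximally entangled state of full Schmidt rank $d^n$. For a code with encoder $\mathcal E^{S\to A'^n}$ this state is $\rho^{AA'^n}=(\mathrm{id}\otimes\mathcal E)(|\phi\rangle\langle\phi|)$,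 but no relation between $\rho^{AA'^n}$ and $\phi$ is required. Let the receiver apply any quantum operation $\mathcal T^{B^n\to\hat S}$ with $|\hat S|=|S|$, and let $F=\langle\phi|\,(\mathrm{id}\otimes\mathcal T)(\mathrm{id}\otimes\mathcal N^{\otimes n})(\rho^{AA'^n})\,|\phi\rangle$ be the fidelity. Then: 1. The maximum defining $Q(\mathcal N)$ is attained and $Q(\mathcal N)=(1-2p)^+\ln d$. 2. For every $s\in[-\tfrac12,0)$, $$F\le\exp\{n[s\mathcal R-E_0(s)]\},\qquad E_0(s)=-\ln\left[(1-p)d^{-s}+p\,d^{s}\right].$$ 3. (Strong converse.) For every $R>Q(\mathcal N)$ there is a constant $c>0$, depending only on $d$, $p$ and $R$, such that $F\le e^{-cn}$ for all $n\ge1$ and all choices of $A$, $S$, $\phi$, $\rho^{AA'^n}$ and $\mathcal T$ as above with rate $\mathcal R\ge R$. -/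

import Mathlib

open scoped Matrix ComplexOrder

noncomputable section

/-! Finite-dimensional quantum systems are described by finite index types: operators on the space
with orthonormal basis `ι` are matrices over `ι`, and the system `A ⊗ B` is indexed by `α × β`. -/

/-- The rank-one operator `|ψ⟩⟨ψ|`. -/
def ketbra {ι : Type*} (ψ : ι → ℂ) : Matrix ι ι ℂ :=
  Matrix.vecMulVec ψ (star ψ)

/-- Density matrices: positive semidefinite with unit trace. -/
def IsDensity {ι : Type*} [Fintype ι] (ρ : Matrix ι ι ℂ) : Prop :=
  ρ.PosSemidef ∧ ρ.trace = 1

/-- The partial trace over the first system. -/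
def traceLeft {α β : Type*} [Fintype α] (ρ : Matrix (α × β) (α × β) ℂ) : Matrix β β ℂ :=
  Matrix.of fun b b' => ∑ a, ρ (a, b) (a, b')

/-- The map `X ↦ ∑ r, K r * X * (K r)ᴴ` with Kraus operators `K r`. -/
def krausMap {R ι κ : Type*} [Fintype R] [Fintype ι] (K : R → Matrix κ ι ℂ)
    (X : Matrix ι ι ℂ) : Matrix κ κ ℂ :=
  ∑ r, K r * X * (K r)ᴴ

/-- Quantum operations (completely positive trace preserving maps), in Kraus form. -/
def IsChannel {ι κ : Type*} [Fintype ι] [DecidableEq ι] [Fintype κ]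
    (T : Matrix ι ι ℂ → Matrix κ κ ℂ) : Prop :=
  ∃ (r : ℕ) (K : Fin r → Matrix κ ι ℂ), ∑ j, (K j)ᴴ * K j = 1 ∧ T = krausMap K

/-- `id ⊗ T`: the (linear) map `T` acting on the second of two systems. -/
def applyRight {α ι κ : Type*} (T : Matrix ι ι ℂ → Matrix κ κ ℂ)
    (X : Matrix (α × ι) (α × ι) ℂ) : Matrix (α × κ) (α × κ) ℂ :=
  Matrix.of fun u v => T (Matrix.of fun i j => X (u.1, i) (v.1, j)) u.2 v.2

/-- The Kraus operators of the erasure channel with input dimension `d`. The output basis is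
`Option (Fin d)`, where `none` labels the erasure state `|e⟩`. The operator labelled `none` is
`√(1-p) ∑ i, |i⟩⟨i|`, and the operator labelled `some i` is `√p |e⟩⟨i|`. -/
def erasureKraus (d : ℕ) (p : ℝ) : Option (Fin d) → Matrix (Option (Fin d)) (Fin d) ℂ
  | none => Matrix.of fun y x => if y = some x then (Real.sqrt (1 - p) : ℂ) else 0
  | some i => Matrix.of fun y x => if y = none ∧ x = i then (Real.sqrt p : ℂ) else 0

/-- The quantum erasure channel. -/
def erasureChannel (d : ℕ) (p : ℝ) :
    Matrix (Fin d) (Fin d) ℂ → Matrix (Option (Fin d)) (Option (Fin d)) ℂ :=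
  krausMap (erasureKraus d p)

/-- The Kraus operators of the `n`-fold tensor power of a channel with Kraus operators `K r`:
all tensor products `K (f 0) ⊗ ⋯ ⊗ K (f (n-1))`. -/
def tensorPowKraus {R ι κ : Type*} (K : R → Matrix κ ι ℂ) (n : ℕ) (f : Fin n → R) :
    Matrix (Fin n → κ) (Fin n → ι) ℂ :=
  Matrix.of fun y x => ∏ k, K (f k) (y k) (x k)

/-- `n` independent uses of the quantum erasure channel. -/
def erasureChannelPow (d : ℕ) (p : ℝ) (n : ℕ) :
    Matrix (Fin n → Fin d) (Fin n → Fin d) ℂ →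
      Matrix (Fin n → Option (Fin d)) (Fin n → Option (Fin d)) ℂ :=
  krausMap (tensorPowKraus (erasureKraus d p) n)

/-- The von Neumann entropy `-Tr ρ ln ρ` of a Hermitian matrix, through its eigenvalues. -/
def vonNeumannEntropy {ι : Type*} [Fintype ι] [DecidableEq ι] (ρ : Matrix ι ι ℂ) : ℝ :=
  open Classical in
  if h : ρ.IsHermitian then ∑ i, Real.negMulLog (h.eigenvalues i) else 0

/-- The coherent information `I(A⟩B) = H(B) - H(A,B)`. -/
def coherentInfo {α β : Type*} [Fintype α] [DecidableEq α] [Fintype β] [DecidableEq β]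
    (σ : Matrix (α × β) (α × β) ℂ) : ℝ :=
  vonNeumannEntropy (traceLeft σ) - vonNeumannEntropy σ

/-- The values `I(A⟩B)` at `(id ⊗ N)(ρ)`, for all states `ρ` of the channel input together with
an arbitrary finite-dimensional reference system `A`. -/
def coherentInfoValues {ι κ : Type*} [Fintype ι] [Fintype κ] [DecidableEq κ]
    (N : Matrix ι ι ℂ → Matrix κ κ ℂ) : Set ℝ :=
  {x | ∃ (a : ℕ) (ρ : Matrix (Fin a × ι) (Fin a × ι) ℂ),
    IsDensity ρ ∧ x = coherentInfo (applyRight N ρ)}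

/-- The coherent information `Q(N)` of a channel. -/
def channelCoherentInfo {ι κ : Type*} [Fintype ι] [Fintype κ] [DecidableEq κ]
    (N : Matrix ι ι ℂ → Matrix κ κ ℂ) : ℝ :=
  sSup (coherentInfoValues N)

/-- `ρ` is a (pure) maximally entangled state of Schmidt rank `r`: `ρ = |ψ⟩⟨ψ|` where
`ψ = r^{-1/2} ∑ i, e i ⊗ f i` for orthonormal families `e`, `f` of `r` vectors. -/
def IsMaxEntangled {α β : Type*} [Fintype α] [Fintype β] (r : ℕ)
    (ρ : Matrix (α × β) (α × β) ℂ) : Prop :=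
  0 < r ∧ ∃ (e : Fin r → EuclideanSpace ℂ α) (f : Fin r → EuclideanSpace ℂ β),
    Orthonormal ℂ e ∧ Orthonormal ℂ f ∧
      ρ = ketbra fun u => ((Real.sqrt r : ℂ))⁻¹ * ∑ i, e i u.1 * f i u.2

/-- `φ` is a unit vector of the system `A S`, where `S` has dimension `m` and is in the
completely mixed state `1/m`. -/
def IsInformationState {α : Type*} [Fintype α] {m : ℕ} (φ : α × Fin m → ℂ) : Prop :=
  star φ ⬝ᵥ φ = 1 ∧ traceLeft (ketbra φ) = (m : ℂ)⁻¹ • (1 : Matrix (Fin m) (Fin m) ℂ)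

/-- The fidelity `⟨φ|ω|φ⟩`. -/
def pureFidelity {ι : Type*} [Fintype ι] (φ : ι → ℂ) (ω : Matrix ι ι ℂ) : ℝ :=
  (star φ ⬝ᵥ (ω *ᵥ φ)).re

/-- The state of the reference `A` and Bob's decoded system, when the channel inputs of `n` uses
of the erasure channel and `A` are in the state `ρ`, and Bob applies `T` to the outputs. -/
def decodedState {α : Type*} (d : ℕ) (p : ℝ) (n m : ℕ)
    (T : Matrix (Fin n → Option (Fin d)) (Fin n → Option (Fin d)) ℂ → Matrix (Fin m) (Fin m) ℂ)
    (ρ : Matrix (α × (Fin n → Fin d)) (α × (Fin n → Fin d)) ℂ) :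
    Matrix (α × Fin m) (α × Fin m) ℂ :=
  applyRight T (applyRight (erasureChannelPow d p n) ρ)

/-- The communication rate `ln |S| / n` (in nats) of a protocol with `n` channel uses and
`|S| = m`. -/
def commRate (n m : ℕ) : ℝ :=
  Real.log m / n

/-- `E₀(s) = -ln[(1-p) d^{-s} + p d^s]`. -/
def erasureE0 (d : ℕ) (p s : ℝ) : ℝ :=
  -Real.log ((1 - p) * (d : ℝ) ^ (-s) + p * (d : ℝ) ^ s)

end

/-! Coherent information. The erasure flag is orthogonal to the input space, so the output is a
direct sum of `(1-p) ρ` and `p ρ_A`. The mixing entropy cancels, leaving `(1-p) (H(A') - H(AA')) - p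
H(A)`. Araki–Lieb and `H(A') ≤ ln d` bound this, and a pure product state or a maximally entangled
state attains the bound. The work here lies in the entropy inequalities.

Fidelity. Full Schmidt rank makes the channel input completely mixed, so the Hilbert–Schmidt
orthogonal Kraus strings send `ψ` to orthogonal vectors. Group the strings by the set `S` of
transmitted uses. Such a group has probability `q = (1-p)^#S p^(n-#S)`, spread evenly over
`d^(n-#S)` vectors, while the receiver's part lies in a space of dimension `d^#S`. Its fidelity is
at most `q`, and by Bessel's inequality at most `q t` with `t = d^#S / d^(n-#S) / m`
(`fidelity_transmitted_le`). Since `min 1 t ≤ t^(-s)`, the binomial theorem over all `S` gives the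
exponential bound.

Strong converse. The exponent `s R - E₀(s)` vanishes at `s = 0` with slope `R - (1-2p) ln d > 0`, so
it is negative at some small negative `s`. -/

set_option linter.unusedSectionVars false

/-! ### Von Neumann entropy through characteristic polynomials -/

section Entropy

open Matrix Polynomial Real

variable {ι κ α β : Type*} [Fintype ι] [DecidableEq ι] [Fintype κ] [DecidableEq κ]
  [Fintype α] [DecidableEq α] [Fintype β] [DecidableEq β]

/-- The partial trace over the second system. -/
def traceRight {α β : Type*} [Fintype β] (ρ : Matrix (α × β) (α × β) ℂ) : Matrix α α ℂ :=
  Matrix.of fun a a' => ∑ b, ρ (a, b) (a', b)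

/-- The sum of `negMulLog` over the roots of a polynomial, with multiplicity. -/
noncomputable def rootEntropy (q : ℂ[X]) : ℝ :=
  (q.roots.map fun z => negMulLog z.re).sum

lemma vonNeumannEntropy_of_isHermitian {ρ : Matrix ι ι ℂ} (h : ρ.IsHermitian) :
    vonNeumannEntropy ρ = ∑ i, negMulLog (h.eigenvalues i) := by
  unfold vonNeumannEntropy
  rw [dif_pos h]

lemma rootEntropy_prod {J : Type*} [Fintype J] (f : J → ℝ) :
    rootEntropy (∏ j, (X - C (f j : ℂ))) = ∑ j, negMulLog (f j) := by
  unfold rootEntropy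
  rw [Polynomial.roots_prod]
  · simp
  · exact Finset.prod_ne_zero_iff.2 fun j _ => X_sub_C_ne_zero _

lemma rootEntropy_mul {q r : ℂ[X]} (hq : q ≠ 0) (hr : r ≠ 0) :
    rootEntropy (q * r) = rootEntropy q + rootEntropy r := by
  simp [rootEntropy, Polynomial.roots_mul (mul_ne_zero hq hr)]

/-- Zero roots contribute `negMulLog 0 = 0`; this allows matrices of different sizes to be compared.
-/
lemma rootEntropy_X_pow_mul (k : ℕ) {q : ℂ[X]} (hq : q ≠ 0) :
    rootEntropy (X ^ k * q) = rootEntropy q := by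
  rw [rootEntropy_mul (pow_ne_zero _ X_ne_zero) hq]
  simp [rootEntropy, Multiset.map_nsmul, Multiset.sum_nsmul]

/-- Entropy depends only on the characteristic polynomial, so its invariances reduce to `charpoly`
identities. -/
lemma vonNeumannEntropy_eq_rootEntropy {ρ : Matrix ι ι ℂ} (h : ρ.IsHermitian) :
    vonNeumannEntropy ρ = rootEntropy ρ.charpoly := by
  rw [vonNeumannEntropy_of_isHermitian h, h.charpoly_eq]
  exact (rootEntropy_prod _).symm

/-- The two characteristic polynomials agree up to powers of `X`. Read on a reshaped bipartite
vector, this equates the entropies of the two marginals of a pure state. -/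
lemma vonNeumannEntropy_mul_conjTranspose (M : Matrix ι κ ℂ) :
    vonNeumannEntropy (M * Mᴴ) = vonNeumannEntropy (Mᴴ * M) := by
  rw [vonNeumannEntropy_eq_rootEntropy (isHermitian_mul_conjTranspose_self M),
    vonNeumannEntropy_eq_rootEntropy (isHermitian_conjTranspose_mul_self M),
    ← rootEntropy_X_pow_mul (Fintype.card κ) (charpoly_monic _).ne_zero, charpoly_mul_comm',
    rootEntropy_X_pow_mul _ (charpoly_monic _).ne_zero]

lemma vonNeumannEntropy_transpose {ρ : Matrix ι ι ℂ} (h : ρ.IsHermitian) :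
    vonNeumannEntropy ρᵀ = vonNeumannEntropy ρ := by
  rw [vonNeumannEntropy_eq_rootEntropy h, vonNeumannEntropy_eq_rootEntropy h.transpose,
    charpoly_transpose]

lemma vonNeumannEntropy_diagonal (f : ι → ℝ) :
    vonNeumannEntropy (diagonal fun i => (f i : ℂ)) = ∑ i, negMulLog (f i) := by
  rw [vonNeumannEntropy_eq_rootEntropy, charpoly_diagonal, rootEntropy_prod]
  exact isHermitian_diagonal_of_self_adjoint _ (by ext i; simp)

lemma vonNeumannEntropy_conj {ρ : Matrix ι ι ℂ} (h : ρ.IsHermitian) {U : Matrix ι ι ℂ}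
    (hU : U * Uᴴ = 1) : vonNeumannEntropy (Uᴴ * ρ * U) = vonNeumannEntropy ρ := by
  rw [vonNeumannEntropy_eq_rootEntropy h,
    vonNeumannEntropy_eq_rootEntropy (isHermitian_conjTranspose_mul_mul U h), mul_assoc,
    charpoly_mul_comm, mul_assoc, hU, mul_one]

lemma vonNeumannEntropy_reindex {ρ : Matrix ι ι ℂ} (h : ρ.IsHermitian) (e : ι ≃ κ) :
    vonNeumannEntropy (reindex e e ρ) = vonNeumannEntropy ρ := by
  rw [vonNeumannEntropy_eq_rootEntropy h, vonNeumannEntropy_eq_rootEntropy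
    (show (reindex e e ρ).IsHermitian from h.submatrix _), charpoly_reindex]

lemma vonNeumannEntropy_fromBlocks {P : Matrix ι ι ℂ} {Q : Matrix κ κ ℂ} (hP : P.IsHermitian)
    (hQ : Q.IsHermitian) :
    vonNeumannEntropy (fromBlocks P 0 0 Q) = vonNeumannEntropy P + vonNeumannEntropy Q := by
  rw [vonNeumannEntropy_eq_rootEntropy hP, vonNeumannEntropy_eq_rootEntropy hQ,
    vonNeumannEntropy_eq_rootEntropy (hP.fromBlocks (by simp) hQ),
    charpoly_fromBlocks_zero₁₂,
    rootEntropy_mul (charpoly_monic _).ne_zero (charpoly_monic _).ne_zero]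

lemma exists_unitary_diagonalization {ρ : Matrix ι ι ℂ} (h : ρ.IsHermitian) :
    ∃ U : Matrix ι ι ℂ, U * Uᴴ = 1 ∧ Uᴴ * U = 1 ∧
      Uᴴ * ρ * U = diagonal fun i => (h.eigenvalues i : ℂ) := by
  have h1 : (h.eigenvectorUnitary : Matrix ι ι ℂ) * (h.eigenvectorUnitary : Matrix ι ι ℂ)ᴴ = 1 :=
    (Matrix.mem_unitaryGroup_iff).1 h.eigenvectorUnitary.2
  have h2 : (h.eigenvectorUnitary : Matrix ι ι ℂ)ᴴ * (h.eigenvectorUnitary : Matrix ι ι ℂ) = 1 :=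
    (Matrix.mem_unitaryGroup_iff').1 h.eigenvectorUnitary.2
  refine ⟨h.eigenvectorUnitary, h1, h2, ?_⟩
  have h3 := h.spectral_theorem
  rw [Unitary.conjStarAlgAut_apply, star_eq_conjTranspose] at h3
  calc _ = (h.eigenvectorUnitary : Matrix ι ι ℂ)ᴴ * ((h.eigenvectorUnitary : Matrix ι ι ℂ) *
        diagonal (RCLike.ofReal ∘ h.eigenvalues) * (h.eigenvectorUnitary : Matrix ι ι ℂ)ᴴ) *
          (h.eigenvectorUnitary : Matrix ι ι ℂ) := by rw [← h3]
    _ = _ := by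
      simp only [mul_assoc, h2, mul_one]
      rw [← mul_assoc, h2, one_mul]
      rfl

lemma sum_eigenvalues_eq_one {ρ : Matrix ι ι ℂ} (h : ρ.IsHermitian) (htr : ρ.trace = 1) :
    ∑ i, h.eigenvalues i = 1 := by
  have := htr.symm.trans h.trace_eq_sum_eigenvalues
  exact Complex.ofReal_injective (by simpa using this.symm)

lemma isHermitian_ofReal_smul {ι : Type*} {ρ : Matrix ι ι ℂ} (h : ρ.IsHermitian) (c : ℝ) :
    ((c : ℂ) • ρ).IsHermitian := by
  unfold IsHermitian
  rw [conjTranspose_smul, h.eq]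
  simp

lemma vonNeumannEntropy_smul {ρ : Matrix ι ι ℂ} (h : ρ.IsHermitian) (htr : ρ.trace = 1) (c : ℝ) :
    vonNeumannEntropy ((c : ℂ) • ρ) = negMulLog c + c * vonNeumannEntropy ρ := by
  obtain ⟨U, hU, -, hd⟩ := exists_unitary_diagonalization h
  rw [← vonNeumannEntropy_conj (isHermitian_ofReal_smul h c) hU, Matrix.mul_smul, Matrix.smul_mul,
    hd, vonNeumannEntropy_of_isHermitian h]
  have hD : (c : ℂ) • (diagonal fun i => (h.eigenvalues i : ℂ)) =
      diagonal fun i => ((c * h.eigenvalues i : ℝ) : ℂ) := by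
    ext i j
    simp [diagonal_apply]
  have ht := sum_eigenvalues_eq_one h htr
  rw [hD, vonNeumannEntropy_diagonal, Finset.mul_sum]
  simp only [negMulLog_mul]
  rw [Finset.sum_add_distrib, ← Finset.sum_mul, ht, one_mul]

/-- The diagonal is the spectrum averaged by the doubly stochastic matrix `|U i j|²`; concavity of
`negMulLog` does the rest. -/
lemma vonNeumannEntropy_le_diag {ρ : Matrix ι ι ℂ} (h : ρ.PosSemidef) :
    vonNeumannEntropy ρ ≤ ∑ i, negMulLog (ρ i i).re := by
  obtain ⟨U, hU, hU', hd⟩ := exists_unitary_diagonalization h.isHermitian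
  rw [vonNeumannEntropy_of_isHermitian h.isHermitian]
  set lam := h.isHermitian.eigenvalues
  have hρ : ρ = U * diagonal (fun i => (lam i : ℂ)) * Uᴴ := by
    rw [← hd]
    simp only [← mul_assoc, hU, one_mul]
    rw [mul_assoc, hU, mul_one]
  have hrow : ∀ i, ∑ j, Complex.normSq (U i j) = 1 := fun i => by
    have := congrFun (congrFun hU i) i
    simp only [mul_apply, conjTranspose_apply, one_apply_eq, RCLike.star_def,
      Complex.mul_conj] at this
    exact_mod_cast this
  have hcol : ∀ j, ∑ i, Complex.normSq (U i j) = 1 := fun j => by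
    have := congrFun (congrFun hU' j) j
    simp only [mul_apply, conjTranspose_apply, one_apply_eq, RCLike.star_def,
      mul_comm _ (U _ _), Complex.mul_conj] at this
    exact_mod_cast this
  have hdiag : ∀ i, (ρ i i).re = ∑ j, Complex.normSq (U i j) * lam j := fun i => by
    have : ρ i i = ((∑ j, Complex.normSq (U i j) * lam j : ℝ) : ℂ) := by
      rw [hρ, mul_apply]
      push_cast
      refine Finset.sum_congr rfl fun j _ => ?_
      rw [mul_diagonal, conjTranspose_apply, RCLike.star_def, ← Complex.mul_conj]
      ring
    rw [this, Complex.ofReal_re]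
  calc ∑ j, negMulLog (lam j) = ∑ i, ∑ j, Complex.normSq (U i j) * negMulLog (lam j) := by
        rw [Finset.sum_comm]
        exact Finset.sum_congr rfl fun j _ => by rw [← Finset.sum_mul, hcol, one_mul]
    _ ≤ ∑ i, negMulLog (ρ i i).re := Finset.sum_le_sum fun i _ => by
        rw [hdiag]
        exact concaveOn_negMulLog.le_map_sum (fun j _ => Complex.normSq_nonneg _) (hrow i)
          fun j _ => h.eigenvalues_nonneg j

lemma vonNeumannEntropy_nonneg {ρ : Matrix ι ι ℂ} (h : IsDensity ρ) : 0 ≤ vonNeumannEntropy ρ := by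
  rw [vonNeumannEntropy_of_isHermitian h.1.isHermitian]
  have ht := sum_eigenvalues_eq_one h.1.isHermitian h.2
  refine Finset.sum_nonneg fun i _ => negMulLog_nonneg (h.1.eigenvalues_nonneg i) ?_
  rw [← ht]
  exact Finset.single_le_sum (fun j _ => h.1.eigenvalues_nonneg j) (Finset.mem_univ i)

/-- Pointwise Gibbs inequality: `log t ≤ t - 1` at `t = x / r`. The hypothesis `h` excludes `x = 0 <
r`, where the convention `log 0 = 0` would break it. -/
lemma neg_sub_log_le {r x : ℝ} (hr : 0 ≤ r) (hx : 0 ≤ x) (h : x = 0 → r = 0) :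
    negMulLog r + r * log x ≤ x - r := by
  rcases hr.eq_or_lt with rfl | hr
  · simpa using hx
  have hx' : 0 < x := hx.lt_of_ne fun h0 => hr.ne' (h h0.symm)
  have := log_le_sub_one_of_pos (div_pos hx' hr)
  rw [log_div hx'.ne' hr.ne'] at this
  have h2 := mul_le_mul_of_nonneg_left this hr.le
  have h3 : r * (x / r - 1) = x - r := by field_simp
  rw [negMulLog]
  linarith

lemma sum_negMulLog_le_log_card {f : ι → ℝ} (hf : ∀ i, 0 ≤ f i) (hsum : ∑ i, f i = 1) :
    ∑ i, negMulLog (f i) ≤ log (Fintype.card ι) := by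
  have hc : (0 : ℝ) < Fintype.card ι := by
    rcases isEmpty_or_nonempty ι with h | h
    · simp at hsum
    · exact_mod_cast Fintype.card_pos
  have key : ∀ i, negMulLog (f i) + f i * log ((Fintype.card ι : ℝ)⁻¹) ≤
      (Fintype.card ι : ℝ)⁻¹ - f i := fun i =>
    neg_sub_log_le (hf i) (inv_nonneg.2 hc.le) fun h => absurd h (inv_pos.2 hc).ne'
  have := Finset.sum_le_sum fun i (_ : i ∈ Finset.univ) => key i
  rw [Finset.sum_add_distrib, ← Finset.sum_mul, Finset.sum_sub_distrib, hsum, log_inv] at this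
  simp [hc.ne'] at this
  linarith

/-- Gibbs' inequality against the product of the marginals. -/
lemma sum_negMulLog_le_marginals {r : α × β → ℝ} (hr : ∀ u, 0 ≤ r u) (hsum : ∑ u, r u = 1) :
    ∑ u, negMulLog (r u) ≤
      ∑ a, negMulLog (∑ b, r (a, b)) + ∑ b, negMulLog (∑ a, r (a, b)) := by
  set x : α → ℝ := fun a => ∑ b, r (a, b)
  set y : β → ℝ := fun b => ∑ a, r (a, b)
  have hx : ∀ a, 0 ≤ x a := fun a => Finset.sum_nonneg fun b _ => hr _
  have hy : ∀ b, 0 ≤ y b := fun b => Finset.sum_nonneg fun a _ => hr _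
  have hx0 : ∀ a b, x a = 0 → r (a, b) = 0 := fun a b h =>
    (Finset.sum_eq_zero_iff_of_nonneg fun b _ => hr _).1 h b (Finset.mem_univ b)
  have hy0 : ∀ a b, y b = 0 → r (a, b) = 0 := fun a b h =>
    (Finset.sum_eq_zero_iff_of_nonneg fun a _ => hr (a, b)).1 h a (Finset.mem_univ a)
  have hsx : ∑ a, x a = 1 := (Fintype.sum_prod_type r).symm.trans hsum
  have hsy : ∑ b, y b = 1 := (Fintype.sum_prod_type_right r).symm.trans hsum
  have key : ∀ a b, negMulLog (r (a, b)) + (r (a, b) * log (x a) + r (a, b) * log (y b)) ≤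
      x a * y b - r (a, b) := fun a b => by
    by_cases h : x a = 0 ∨ y b = 0
    · have h0 : r (a, b) = 0 := h.elim (hx0 a b) (hy0 a b)
      have := mul_nonneg (hx a) (hy b)
      simpa [h0] using this
    · push Not at h
      have := neg_sub_log_le (hr (a, b)) (mul_nonneg (hx a) (hy b)) fun h0 =>
        absurd h0 (mul_ne_zero h.1 h.2)
      rwa [log_mul h.1 h.2, mul_add] at this
  have := Finset.sum_le_sum fun a (_ : a ∈ Finset.univ) =>
    Finset.sum_le_sum fun b (_ : b ∈ Finset.univ) => key a b
  rw [Fintype.sum_prod_type] at hsum ⊢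
  simp only [Finset.sum_add_distrib, Finset.sum_sub_distrib] at this
  rw [← Finset.sum_mul_sum, hsx, hsy,
    Finset.sum_comm (f := fun a b => r (a, b) * log (y b))] at this
  simp only [← Finset.sum_mul] at this
  have e1 : ∑ a, negMulLog (x a) = -∑ a, (∑ b, r (a, b)) * log (x a) := by
    simp [negMulLog, x]
  have e2 : ∑ b, negMulLog (y b) = -∑ b, (∑ a, r (a, b)) * log (y b) := by
    simp [negMulLog, y]
  rw [e1, e2]
  linarith

/-! ### Partial traces, subadditivity and Araki–Lieb -/

lemma posSemidef_traceLeft {ρ : Matrix (α × β) (α × β) ℂ} (h : ρ.PosSemidef) :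
    (traceLeft ρ).PosSemidef := by
  have : traceLeft ρ = ∑ a, ρ.submatrix (fun b => (a, b)) fun b => (a, b) := by
    ext b b'
    simp [traceLeft, Matrix.sum_apply]
  rw [this]
  exact posSemidef_sum _ fun a _ => h.submatrix _

lemma posSemidef_traceRight {ρ : Matrix (α × β) (α × β) ℂ} (h : ρ.PosSemidef) :
    (traceRight ρ).PosSemidef := by
  have : traceRight ρ = ∑ b, ρ.submatrix (fun a => (a, b)) fun a => (a, b) := by
    ext b b'
    simp [traceRight, Matrix.sum_apply]
  rw [this]
  exact posSemidef_sum _ fun a _ => h.submatrix _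

lemma trace_traceLeft (ρ : Matrix (α × β) (α × β) ℂ) : (traceLeft ρ).trace = ρ.trace := by
  simp [trace, traceLeft, Fintype.sum_prod_type_right]

lemma trace_traceRight (ρ : Matrix (α × β) (α × β) ℂ) : (traceRight ρ).trace = ρ.trace := by
  simp [trace, traceRight, Fintype.sum_prod_type]

lemma IsDensity.traceLeft {ρ : Matrix (α × β) (α × β) ℂ} (h : IsDensity ρ) :
    IsDensity (traceLeft ρ) :=
  ⟨posSemidef_traceLeft h.1, by rw [trace_traceLeft, h.2]⟩

lemma IsDensity.traceRight {ρ : Matrix (α × β) (α × β) ℂ} (h : IsDensity ρ) :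
    IsDensity (traceRight ρ) :=
  ⟨posSemidef_traceRight h.1, by rw [trace_traceRight, h.2]⟩

open Kronecker in
-- The unitary on the traced-out factor cancels inside the trace.
lemma traceLeft_kronecker_conj (ρ : Matrix (α × β) (α × β) ℂ) {U : Matrix α α ℂ}
    (hU : U * Uᴴ = 1) (V : Matrix β β ℂ) :
    traceLeft ((U ⊗ₖ V)ᴴ * ρ * (U ⊗ₖ V)) = Vᴴ * traceLeft ρ * V := by
  have hU' : ∀ a₁ a₂, ∑ a, U a₁ a * star (U a₂ a) = (1 : Matrix α α ℂ) a₁ a₂ := fun a₁ a₂ => by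
    rw [← hU, mul_apply]
    rfl
  ext b b'
  simp only [traceLeft, of_apply, mul_apply, conjTranspose_apply, kroneckerMap_apply,
    Fintype.sum_prod_type, Finset.sum_mul, star_mul']
  calc ∑ a, ∑ a₁, ∑ b₁, ∑ a₂, ∑ b₂,
        star (U a₂ a) * star (V b₂ b) * ρ (a₂, b₂) (a₁, b₁) * (U a₁ a * V b₁ b')
      = ∑ a₁, ∑ b₁, ∑ a₂, ∑ b₂, (∑ a, U a₁ a * star (U a₂ a)) *
          (star (V b₂ b) * ρ (a₂, b₂) (a₁, b₁) * V b₁ b') := by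
        rw [Finset.sum_comm]; refine Finset.sum_congr rfl fun a₁ _ => ?_
        rw [Finset.sum_comm]; refine Finset.sum_congr rfl fun b₁ _ => ?_
        rw [Finset.sum_comm]; refine Finset.sum_congr rfl fun a₂ _ => ?_
        rw [Finset.sum_comm]; refine Finset.sum_congr rfl fun b₂ _ => ?_
        rw [Finset.sum_mul]
        exact Finset.sum_congr rfl fun a _ => by ring
    _ = ∑ a₁, ∑ b₁, ∑ b₂, star (V b₂ b) * ρ (a₁, b₂) (a₁, b₁) * V b₁ b' := by
        refine Finset.sum_congr rfl fun a₁ _ => Finset.sum_congr rfl fun b₁ _ => ?_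
        rw [Finset.sum_eq_single a₁]
        · simp only [hU', one_apply_eq, one_mul]
        · intro a₂ _ h
          simp only [hU', one_apply_ne h.symm, zero_mul, Finset.sum_const_zero]
        · simp
    _ = _ := by
        rw [Finset.sum_comm]
        refine Finset.sum_congr rfl fun b₁ _ => ?_
        rw [Finset.sum_comm]
        refine Finset.sum_congr rfl fun b₂ _ => ?_
        rw [Finset.mul_sum, Finset.sum_mul]

lemma traceRight_eq_traceLeft_reindex (ρ : Matrix (α × β) (α × β) ℂ) :
    traceRight ρ = traceLeft (reindex (Equiv.prodComm α β) (Equiv.prodComm α β) ρ) := rfl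

open Kronecker in
lemma traceRight_kronecker_conj (ρ : Matrix (α × β) (α × β) ℂ) (U : Matrix α α ℂ)
    {V : Matrix β β ℂ} (hV : V * Vᴴ = 1) :
    traceRight ((U ⊗ₖ V)ᴴ * ρ * (U ⊗ₖ V)) = Uᴴ * traceRight ρ * U := by
  rw [traceRight_eq_traceLeft_reindex, traceRight_eq_traceLeft_reindex,
    ← traceLeft_kronecker_conj _ hV]
  congr 1
  have hk : reindex (Equiv.prodComm α β) (Equiv.prodComm α β) (U ⊗ₖ V) = V ⊗ₖ U := by
    ext u v
    simp [mul_comm]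
  rw [← hk]
  simp only [reindex_apply, conjTranspose_submatrix, submatrix_mul_equiv]

open Kronecker in
/-- Subadditivity of the von Neumann entropy. -/
lemma vonNeumannEntropy_subadditive {ρ : Matrix (α × β) (α × β) ℂ} (h : IsDensity ρ) :
    vonNeumannEntropy ρ ≤ vonNeumannEntropy (traceRight ρ) + vonNeumannEntropy (traceLeft ρ) := by
  have hR := h.traceRight.1.isHermitian
  have hL := h.traceLeft.1.isHermitian
  -- In the product of the local eigenbases, the diagonal of the state is a joint distribution whose
  -- marginals are the spectra of the two reduced states. Classical subadditivity then applies.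
  obtain ⟨U, hU, -, hUd⟩ := exists_unitary_diagonalization hR
  obtain ⟨V, hV, -, hVd⟩ := exists_unitary_diagonalization hL
  have hW : (U ⊗ₖ V) * (U ⊗ₖ V)ᴴ = 1 := by
    rw [conjTranspose_kronecker, ← mul_kronecker_mul, hU, hV, one_kronecker_one]
  rw [← vonNeumannEntropy_conj h.1.isHermitian hW]
  have hpsd : ((U ⊗ₖ V)ᴴ * ρ * (U ⊗ₖ V)).PosSemidef := h.1.conjTranspose_mul_mul_same _
  have htr : ((U ⊗ₖ V)ᴴ * ρ * (U ⊗ₖ V)).trace = 1 := by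
    rw [trace_mul_comm, ← mul_assoc, hW, one_mul, h.2]
  have hRd := traceRight_kronecker_conj ρ U hV
  have hLd := traceLeft_kronecker_conj ρ hU V
  rw [hUd] at hRd
  rw [hVd] at hLd
  set τ := (U ⊗ₖ V)ᴴ * ρ * (U ⊗ₖ V)
  refine (vonNeumannEntropy_le_diag hpsd).trans ?_
  have hnn : ∀ u, 0 ≤ (τ u u).re := fun u => (Complex.le_def.1 (hpsd.diag_nonneg (i := u))).1
  have hsum : ∑ u, (τ u u).re = 1 := by
    rw [← Complex.re_sum]
    exact congrArg Complex.re htr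
  refine (sum_negMulLog_le_marginals hnn hsum).trans_eq ?_
  rw [vonNeumannEntropy_of_isHermitian hR, vonNeumannEntropy_of_isHermitian hL]
  congr 1
  · refine Finset.sum_congr rfl fun a _ => ?_
    have := congrArg Complex.re (congrFun (congrFun hRd a) a)
    simp only [traceRight, of_apply, Complex.re_sum, diagonal_apply_eq, Complex.ofReal_re] at this
    exact congrArg negMulLog this
  · refine Finset.sum_congr rfl fun b _ => ?_
    have := congrArg Complex.re (congrFun (congrFun hLd b) b)
    simp only [traceLeft, of_apply, Complex.re_sum, diagonal_apply_eq, Complex.ofReal_re] at this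
    exact congrArg negMulLog this

open scoped MatrixOrder Matrix.Norms.L2Operator in
/-- The Araki–Lieb inequality. -/
lemma vonNeumannEntropy_traceLeft_le {ρ : Matrix (α × β) (α × β) ℂ} (h : IsDensity ρ) :
    vonNeumannEntropy (traceLeft ρ) ≤ vonNeumannEntropy ρ + vonNeumannEntropy (traceRight ρ) := by
  obtain ⟨B, hB⟩ := CStarAlgebra.nonneg_iff_eq_star_mul_self.mp h.1.nonneg
  rw [star_eq_conjTranspose] at hB
  -- A purification of `ρ`, with reference indexed by `α × β`, reshaped as a matrix from `α` and the
  -- reference to `β`. Then `M * Mᴴ` is the marginal on `β`, and `τ` is the state of the complement,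
  -- isospectral to it up to zeros; subadditivity is applied to `τ`.
  set M : Matrix β (α × (α × β)) ℂ := of fun b u => star (B u.2 (u.1, b)) with hM
  have h1 : M * Mᴴ = traceLeft ρ := by
    ext b b'
    simp [hM, hB, mul_apply, traceLeft, Fintype.sum_prod_type (α₁ := α)]
  set τ := (Mᴴ * M)ᵀ with hτ
  have hH := isHermitian_conjTranspose_mul_self M
  have h2 : vonNeumannEntropy τ = vonNeumannEntropy (traceLeft ρ) := by
    rw [vonNeumannEntropy_transpose hH, ← vonNeumannEntropy_mul_conjTranspose, h1]
  have h3 : traceRight τ = traceRight ρ := by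
    ext a a'
    simp only [hτ, hM, hB, mul_apply, traceRight, of_apply, transpose_apply, conjTranspose_apply,
      star_star]
    rw [Finset.sum_comm]
    exact Finset.sum_congr rfl fun _ _ => Finset.sum_congr rfl fun _ _ => mul_comm _ _
  have h4 : traceLeft τ = (B * Bᴴ)ᵀ := by
    ext k k'
    simp only [hτ, hM, mul_apply, traceLeft, of_apply, transpose_apply, conjTranspose_apply,
      star_star]
    rw [Fintype.sum_prod_type]
  have hd : IsDensity τ := ⟨(posSemidef_conjTranspose_mul_self M).transpose, by
    rw [trace_transpose, trace_mul_comm, h1, trace_traceLeft, h.2]⟩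
  have := vonNeumannEntropy_subadditive hd
  rw [h2, h3, h4, vonNeumannEntropy_transpose (isHermitian_mul_conjTranspose_self B),
    vonNeumannEntropy_mul_conjTranspose, ← hB] at this
  linarith

lemma vonNeumannEntropy_le_log_card {ρ : Matrix ι ι ℂ} (h : IsDensity ρ) :
    vonNeumannEntropy ρ ≤ log (Fintype.card ι) := by
  rw [vonNeumannEntropy_of_isHermitian h.1.isHermitian]
  exact sum_negMulLog_le_log_card h.1.eigenvalues_nonneg
    (sum_eigenvalues_eq_one h.1.isHermitian h.2)

lemma vonNeumannEntropy_ketbra {ψ : ι → ℂ} (h : star ψ ⬝ᵥ ψ = 1) :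
    vonNeumannEntropy (ketbra ψ) = 0 := by
  have h1 : ketbra ψ = replicateCol Unit ψ * (replicateCol Unit ψ)ᴴ := by
    rw [ketbra, vecMulVec_eq Unit, conjTranspose_replicateCol]
  have h2 : (replicateCol Unit ψ)ᴴ * replicateCol Unit ψ = diagonal fun _ => ((1 : ℝ) : ℂ) := by
    ext i j
    simpa [mul_apply, dotProduct] using h
  rw [h1, vonNeumannEntropy_mul_conjTranspose, h2, vonNeumannEntropy_diagonal]
  simp

lemma isDensity_ketbra {ψ : ι → ℂ} (h : star ψ ⬝ᵥ ψ = 1) : IsDensity (ketbra ψ) :=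
  ⟨posSemidef_vecMulVec_self_star ψ, by
    rw [ketbra, trace_vecMulVec, dotProduct_comm, h]⟩

lemma vonNeumannEntropy_completelyMixed [Nonempty ι] :
    vonNeumannEntropy ((Fintype.card ι : ℂ)⁻¹ • (1 : Matrix ι ι ℂ)) = log (Fintype.card ι) := by
  have : (Fintype.card ι : ℂ)⁻¹ • (1 : Matrix ι ι ℂ) =
      diagonal fun _ => (((Fintype.card ι : ℝ)⁻¹ : ℝ) : ℂ) := by
    rw [smul_one_eq_diagonal]
    simp
  rw [this, vonNeumannEntropy_diagonal]
  simp [negMulLog, log_inv]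

end Entropy

/-! ### Coherent information of the erasure channel -/

section ErasureCoherentInformation

open Matrix Real

lemma erasureChannel_apply (d : ℕ) (p : ℝ) (hp0 : 0 ≤ p) (hp1 : p ≤ 1)
    (X : Matrix (Fin d) (Fin d) ℂ) :
    erasureChannel d p X = of fun y y' => match y, y' with
      | some i, some j => ((1 - p : ℝ) : ℂ) * X i j
      | none, none => (p : ℂ) * X.trace
      | _, _ => 0 := by
  have h1 : (√(1 - p) : ℂ) * √(1 - p) = ((1 - p : ℝ) : ℂ) := by
    rw [← Complex.ofReal_mul, mul_self_sqrt (by linarith)]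
  have h2 : (√p : ℂ) * √p = p := by
    rw [← Complex.ofReal_mul, mul_self_sqrt hp0]
  have hnone : ∀ y y', (erasureKraus d p none * X * (erasureKraus d p none)ᴴ) y y' =
      match y, y' with
      | some i, some j => ((1 - p : ℝ) : ℂ) * X i j
      | _, _ => 0 := by
    rintro (_ | i) (_ | j) <;>
      simp [mul_apply, erasureKraus, apply_ite (starRingEnd ℂ)]
    rw [mul_right_comm, h1, Complex.ofReal_sub, Complex.ofReal_one]
  have hsome : ∀ k y y', (erasureKraus d p (some k) * X * (erasureKraus d p (some k))ᴴ) y y' =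
      match y, y' with
      | none, none => (p : ℂ) * X k k
      | _, _ => 0 := by
    rintro k (_ | i) (_ | j) <;> simp [mul_apply, erasureKraus, apply_ite (starRingEnd ℂ)]
    rw [mul_right_comm, h2]
  ext y y'
  rw [erasureChannel, krausMap, Matrix.sum_apply, Fintype.sum_option, hnone]
  simp only [hsome]
  rcases y with _ | i <;> rcases y' with _ | j <;> simp [trace, Finset.mul_sum]

/-- The output of the erasure channel splits into a transmitted and an erased part. -/
def prodOptionEquivSum (α β : Type*) : α × Option β ≃ (α × β) ⊕ α :=
  (((Equiv.refl α).prodCongr (Equiv.optionEquivSumPUnit.{0} β)).trans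
    (Equiv.prodSumDistrib α β PUnit.{1})).trans ((Equiv.refl _).sumCongr (Equiv.prodPUnit.{0} α))

variable {α : Type*} [Fintype α] [DecidableEq α]

lemma reindex_applyRight_erasureChannel {d : ℕ} {p : ℝ} (hp0 : 0 ≤ p) (hp1 : p ≤ 1)
    (ρ : Matrix (α × Fin d) (α × Fin d) ℂ) :
    reindex (prodOptionEquivSum α (Fin d)) (prodOptionEquivSum α (Fin d))
        (applyRight (erasureChannel d p) ρ) =
      fromBlocks (((1 - p : ℝ) : ℂ) • ρ) 0 0 ((p : ℂ) • traceRight ρ) := by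
  ext (⟨a, i⟩ | a) (⟨b, j⟩ | b) <;>
    simp [prodOptionEquivSum, applyRight, erasureChannel_apply d p hp0 hp1, traceRight, trace]

lemma reindex_traceLeft_applyRight_erasureChannel {d : ℕ} {p : ℝ} (hp0 : 0 ≤ p) (hp1 : p ≤ 1)
    {ρ : Matrix (α × Fin d) (α × Fin d) ℂ} (h : ρ.trace = 1) :
    reindex (Equiv.optionEquivSumPUnit.{0} (Fin d)) (Equiv.optionEquivSumPUnit.{0} (Fin d))
        (traceLeft (applyRight (erasureChannel d p) ρ)) =
      fromBlocks (((1 - p : ℝ) : ℂ) • traceLeft ρ) 0 0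
        (diagonal fun _ : PUnit.{1} => (p : ℂ)) := by
  ext (i | i) (j | j) <;>
    simp [applyRight, erasureChannel_apply d p hp0 hp1, traceLeft, trace, Finset.mul_sum]
  rw [trace, Fintype.sum_prod_type] at h
  simp only [diag_apply] at h
  simp only [← Finset.mul_sum]
  rw [h, mul_one]

/-- Both output entropies contain `negMulLog (1 - p) + negMulLog p`, which cancels in the
difference. -/
lemma coherentInfo_applyRight_erasureChannel {d : ℕ} {p : ℝ} (hp0 : 0 ≤ p) (hp1 : p ≤ 1)
    {ρ : Matrix (α × Fin d) (α × Fin d) ℂ} (h : IsDensity ρ) :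
    coherentInfo (applyRight (erasureChannel d p) ρ) =
      (1 - p) * (vonNeumannEntropy (traceLeft ρ) - vonNeumannEntropy ρ) -
        p * vonNeumannEntropy (traceRight ρ) := by
  have hρ := isHermitian_ofReal_smul h.1.isHermitian (1 - p)
  have hR := isHermitian_ofReal_smul h.traceRight.1.isHermitian p
  have hL := isHermitian_ofReal_smul h.traceLeft.1.isHermitian (1 - p)
  have hD : (diagonal fun _ : PUnit.{1} => (p : ℂ)).IsHermitian :=
    isHermitian_diagonal_of_self_adjoint _ (by ext i; simp)
  have h1 := reindex_applyRight_erasureChannel hp0 hp1 ρ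
  have h2 := reindex_traceLeft_applyRight_erasureChannel hp0 hp1 h.2
  rw [← Equiv.eq_symm_apply, reindex_symm] at h1 h2
  rw [coherentInfo, h2, h1, vonNeumannEntropy_reindex (hρ.fromBlocks (by simp) hR),
    vonNeumannEntropy_reindex (hL.fromBlocks (by simp) hD), vonNeumannEntropy_fromBlocks hρ hR,
    vonNeumannEntropy_fromBlocks hL hD, vonNeumannEntropy_diagonal,
    vonNeumannEntropy_smul h.1.isHermitian h.2,
    vonNeumannEntropy_smul h.traceRight.1.isHermitian h.traceRight.2,
    vonNeumannEntropy_smul h.traceLeft.1.isHermitian h.traceLeft.2]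
  simp
  ring

/-- Put `x = H(A') - H(AA')`, so `x ≤ H(A)` by Araki–Lieb and `x ≤ ln d`. For `2p ≥ 1` the value is
at most `(1-2p) H(A) ≤ 0`; otherwise write it as `(1-2p) x + p (x - H(A))`. -/
lemma coherentInfo_applyRight_erasureChannel_le {d : ℕ} {p : ℝ} (hp0 : 0 ≤ p) (hp1 : p ≤ 1)
    {ρ : Matrix (α × Fin d) (α × Fin d) ℂ} (h : IsDensity ρ) :
    coherentInfo (applyRight (erasureChannel d p) ρ) ≤ max 0 (1 - 2 * p) * log d := by
  rw [coherentInfo_applyRight_erasureChannel hp0 hp1 h]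
  have hAL := vonNeumannEntropy_traceLeft_le h
  have hρ := vonNeumannEntropy_nonneg h
  have hR := vonNeumannEntropy_nonneg h.traceRight
  have hL := vonNeumannEntropy_le_log_card h.traceLeft
  rw [Fintype.card_fin] at hL
  rcases le_total (1 - 2 * p) 0 with hp | hp
  · rw [max_eq_left hp]
    nlinarith
  · rw [max_eq_right hp]
    nlinarith

/-- The standard maximally entangled vector. -/
noncomputable def maxEntangledVec (d : ℕ) : Fin d × Fin d → ℂ :=
  fun u => if u.1 = u.2 then (((√d)⁻¹ : ℝ) : ℂ) else 0

lemma traceRight_ketbra_maxEntangledVec (d : ℕ) :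
    traceRight (ketbra (maxEntangledVec d)) = (Fintype.card (Fin d) : ℂ)⁻¹ • 1 := by
  ext i j
  simp only [traceRight, ketbra, vecMulVec_apply, maxEntangledVec, of_apply, Pi.star_apply]
  by_cases hij : i = j
  · subst hij
    simp [← Complex.ofReal_mul, ← mul_inv]
  · simp [hij, Ne.symm hij]

lemma traceLeft_ketbra_maxEntangledVec (d : ℕ) :
    traceLeft (ketbra (maxEntangledVec d)) = (Fintype.card (Fin d) : ℂ)⁻¹ • 1 := by
  ext i j
  simp only [traceLeft, ketbra, vecMulVec_apply, maxEntangledVec, of_apply, Pi.star_apply]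
  by_cases hij : i = j
  · subst hij
    simp [← Complex.ofReal_mul, ← mul_inv]
  · simp [hij]

lemma star_dotProduct_maxEntangledVec {d : ℕ} (hd : 1 ≤ d) :
    star (maxEntangledVec d) ⬝ᵥ maxEntangledVec d = 1 := by
  have h := congrArg Matrix.trace (traceLeft_ketbra_maxEntangledVec d)
  rw [trace_traceLeft, ketbra, trace_vecMulVec, dotProduct_comm] at h
  have hd' : (d : ℂ) ≠ 0 := by exact_mod_cast (by omega : d ≠ 0)
  simpa [hd'] using h

lemma isGreatest_coherentInfoValues_erasureChannel {d : ℕ} (hd : 1 ≤ d) {p : ℝ} (hp0 : 0 ≤ p)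
    (hp1 : p ≤ 1) :
    IsGreatest (coherentInfoValues (erasureChannel d p)) (max 0 (1 - 2 * p) * log d) := by
  refine ⟨?_, ?_⟩
  · rcases le_total (1 - 2 * p) 0 with hp | hp
    -- A one-dimensional reference forces a product state, for which every entropy vanishes.
    · let ψ : Fin 1 × Fin d → ℂ := Pi.single (0, ⟨0, hd⟩) 1
      have hψ : star ψ ⬝ᵥ ψ = 1 := by simp [ψ]
      have hden := isDensity_ketbra hψ
      refine ⟨1, ketbra ψ, hden, ?_⟩
      have hR : vonNeumannEntropy (traceRight (ketbra ψ)) = 0 :=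
        le_antisymm (by simpa using vonNeumannEntropy_le_log_card hden.traceRight)
          (vonNeumannEntropy_nonneg hden.traceRight)
      have hL := vonNeumannEntropy_traceLeft_le hden
      rw [vonNeumannEntropy_ketbra hψ, hR, add_zero] at hL
      rw [coherentInfo_applyRight_erasureChannel hp0 hp1 hden, hR, vonNeumannEntropy_ketbra hψ,
        le_antisymm hL (vonNeumannEntropy_nonneg hden.traceLeft), max_eq_left hp]
      simp
    · have hψ := star_dotProduct_maxEntangledVec hd
      have hden := isDensity_ketbra hψ
      have : Nonempty (Fin d) := ⟨⟨0, hd⟩⟩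
      refine ⟨d, ketbra (maxEntangledVec d), hden, ?_⟩
      rw [coherentInfo_applyRight_erasureChannel hp0 hp1 hden, vonNeumannEntropy_ketbra hψ,
        traceRight_ketbra_maxEntangledVec, traceLeft_ketbra_maxEntangledVec,
        vonNeumannEntropy_completelyMixed, max_eq_right hp, Fintype.card_fin]
      ring
  · rintro x ⟨a, ρ, h, rfl⟩
    exact coherentInfo_applyRight_erasureChannel_le hp0 hp1 h

end ErasureCoherentInformation

/-! ### Fidelity bounds for Kraus decoders -/

section ErasureFidelity

open Matrix Real

variable {α ι κ R J : Type*} [Fintype α] [Fintype ι] [Fintype κ] [Fintype R] [Fintype J]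

/-- The vector `(1 ⊗ K) ψ`. -/
def applyRightVec (K : Matrix κ ι ℂ) (ψ : α × ι → ℂ) : α × κ → ℂ :=
  fun u => ∑ x, K u.2 x * ψ (u.1, x)

lemma applyRight_krausMap_ketbra (K : R → Matrix κ ι ℂ) (ψ : α × ι → ℂ) :
    applyRight (krausMap K) (ketbra ψ) = ∑ r, ketbra (applyRightVec (K r) ψ) := by
  ext u v
  simp only [applyRight, krausMap, of_apply, Matrix.sum_apply, mul_apply, ketbra, vecMulVec_apply,
    applyRightVec, conjTranspose_apply, Pi.star_apply, star_sum, star_mul']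
  refine Finset.sum_congr rfl fun r _ => ?_
  rw [Finset.sum_mul_sum, Finset.sum_comm]
  refine Finset.sum_congr rfl fun x' _ => ?_
  rw [Finset.sum_mul]
  exact Finset.sum_congr rfl fun x _ => by ring

lemma applyRight_krausMap_sum (K : J → Matrix κ ι ℂ) (X : R → Matrix (α × ι) (α × ι) ℂ) :
    applyRight (krausMap K) (∑ r, X r) = ∑ r, applyRight (krausMap K) (X r) := by
  ext u v
  simp only [applyRight, krausMap, of_apply, Matrix.sum_apply]
  rw [Finset.sum_comm]
  refine Finset.sum_congr rfl fun j _ => ?_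
  rw [← Matrix.sum_apply, ← Matrix.sum_mul, ← Matrix.mul_sum]
  have h : (of fun i i' => ∑ r, X r (u.1, i) (v.1, i')) =
      ∑ r, of fun i i' => X r (u.1, i) (v.1, i') := by
    ext i i'
    simp [Matrix.sum_apply]
  rw [h]

lemma pureFidelity_sum (φ : ι → ℂ) (X : R → Matrix ι ι ℂ) :
    pureFidelity φ (∑ r, X r) = ∑ r, pureFidelity φ (X r) := by
  simp only [pureFidelity, sum_mulVec, dotProduct_sum, Complex.re_sum]

lemma pureFidelity_ketbra (φ v : ι → ℂ) :
    pureFidelity φ (ketbra v) = Complex.normSq (star φ ⬝ᵥ v) := by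
  have h : star v ⬝ᵥ φ = star (star φ ⬝ᵥ v) := by
    rw [star_dotProduct]
  have h2 : star φ ⬝ᵥ (ketbra v *ᵥ φ) = (Complex.normSq (star φ ⬝ᵥ v) : ℂ) := by
    rw [ketbra, vecMulVec_mulVec, dotProduct_smul, h, ← Complex.mul_conj]
    simp [MulOpposite.smul_eq_mul_unop]
  rw [pureFidelity, h2, Complex.ofReal_re]

lemma pureFidelity_applyRight_krausMap (K : R → Matrix κ ι ℂ) {S : Type*} [Fintype S]
    (L : J → Matrix S κ ℂ) (ψ : α × ι → ℂ) (φ : α × S → ℂ) :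
    pureFidelity φ (applyRight (krausMap L) (applyRight (krausMap K) (ketbra ψ))) =
      ∑ r, ∑ j, Complex.normSq (star φ ⬝ᵥ applyRightVec (L j) (applyRightVec (K r) ψ)) := by
  simp only [applyRight_krausMap_ketbra, applyRight_krausMap_sum, pureFidelity_sum,
    pureFidelity_ketbra]

lemma star_dotProduct_applyRightVec (L : Matrix κ ι ℂ) (φ : α × κ → ℂ) (v : α × ι → ℂ) :
    star φ ⬝ᵥ applyRightVec L v = star (applyRightVec Lᴴ φ) ⬝ᵥ v := by
  simp only [dotProduct, applyRightVec, Pi.star_apply, Fintype.sum_prod_type, star_sum, star_mul',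
    conjTranspose_apply, star_star, Finset.mul_sum, Finset.sum_mul]
  refine Finset.sum_congr rfl fun a _ => ?_
  rw [Finset.sum_comm]
  exact Finset.sum_congr rfl fun _ _ => Finset.sum_congr rfl fun _ _ => by ring

/-- A marginal proportional to the identity turns overlaps into Hilbert–Schmidt products. The
row-wise form is needed for pulling back the information state; the sum over rows serves the channel
inputs. -/
lemma sum_star_applyRightVec_mul [DecidableEq ι] {ψ : α × ι → ℂ} {c : ℂ}
    (h : traceLeft (ketbra ψ) = c • 1) (K L : Matrix κ ι ℂ) (y : κ) :
    ∑ a, star (applyRightVec K ψ (a, y)) * applyRightVec L ψ (a, y) =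
      c * ∑ x, star (K y x) * L y x := by
  have h' : ∀ x x', ∑ a, ψ (a, x) * star (ψ (a, x')) = c * (1 : Matrix ι ι ℂ) x x' := fun x x' =>
    congrFun (congrFun h x) x'
  simp only [applyRightVec, star_sum, star_mul']
  calc ∑ a, (∑ x', star (K y x') * star (ψ (a, x'))) * ∑ x, L y x * ψ (a, x)
      = ∑ x, ∑ x', star (K y x') * L y x * ∑ a, ψ (a, x) * star (ψ (a, x')) := by
        simp only [Finset.sum_mul, Finset.mul_sum]
        rw [Finset.sum_comm]; refine Finset.sum_congr rfl fun x _ => ?_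
        rw [Finset.sum_comm]; refine Finset.sum_congr rfl fun x' _ => ?_
        exact Finset.sum_congr rfl fun a _ => by ring
    _ = _ := by
        simp only [h', Finset.mul_sum]
        refine Finset.sum_congr rfl fun x _ => ?_
        rw [Finset.sum_eq_single x]
        · rw [one_apply_eq]; ring
        · intro x' _ hx
          rw [one_apply_ne hx.symm]; ring
        · simp

lemma star_applyRightVec_dotProduct [DecidableEq ι] {ψ : α × ι → ℂ} {c : ℂ}
    (h : traceLeft (ketbra ψ) = c • 1) (K L : Matrix κ ι ℂ) :
    star (applyRightVec K ψ) ⬝ᵥ applyRightVec L ψ = c * ∑ y, ∑ x, star (K y x) * L y x := by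
  rw [dotProduct, Fintype.sum_prod_type_right, Finset.mul_sum]
  exact Finset.sum_congr rfl fun y _ => sum_star_applyRightVec_mul h K L y

lemma star_dotProduct_self_eq (v : ι → ℂ) :
    star v ⬝ᵥ v = ((∑ i, Complex.normSq (v i) : ℝ) : ℂ) := by
  rw [dotProduct]
  push_cast
  exact Finset.sum_congr rfl fun i _ => by
    rw [Pi.star_apply, mul_comm, RCLike.star_def, Complex.mul_conj]

/-- Cauchy–Schwarz. -/
lemma normSq_star_dotProduct_le (φ v : ι → ℂ) :
    Complex.normSq (star φ ⬝ᵥ v) ≤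
      (∑ i, Complex.normSq (φ i)) * ∑ i, Complex.normSq (v i) := by
  have h := norm_inner_le_norm (𝕜 := ℂ) (WithLp.toLp 2 φ) (WithLp.toLp 2 v)
  rw [EuclideanSpace.inner_toLp_toLp, dotProduct_comm] at h
  have h2 := pow_le_pow_left₀ (norm_nonneg _) h 2
  rw [mul_pow, EuclideanSpace.norm_sq_eq, EuclideanSpace.norm_sq_eq] at h2
  simpa only [Complex.normSq_eq_norm_sq] using h2

/-- Bessel's inequality for an orthogonal family of vectors of equal length. -/
lemma sum_normSq_star_dotProduct_le [DecidableEq R] (u : R → ι → ℂ) (G : Finset R) {c : ℝ}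
    (hc : 0 ≤ c) (hu : ∀ f ∈ G, ∀ g ∈ G, star (u f) ⬝ᵥ u g = if f = g then (c : ℂ) else 0)
    (v : ι → ℂ) :
    ∑ f ∈ G, Complex.normSq (star v ⬝ᵥ u f) ≤ c * ∑ i, Complex.normSq (v i) := by
  -- For `c = 0` all vectors vanish; otherwise they can be normalised by `√c`.
  rcases hc.eq_or_lt with rfl | hc
  · rw [zero_mul]
    refine Finset.sum_nonpos fun f hf => ?_
    have h0 : star (u f) ⬝ᵥ u f = 0 := by simpa using hu f hf f hf
    rw [dotProduct_star_self_eq_zero.1 h0]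
    simp
  · let e : G → EuclideanSpace ℂ ι := fun f => WithLp.toLp 2 (((√c)⁻¹ : ℂ) • u f)
    have he : Orthonormal ℂ e := by
      rw [orthonormal_iff_ite]
      rintro ⟨f, hf⟩ ⟨g, hg⟩
      have hcc : (√c : ℂ) * √c = c := by rw [← Complex.ofReal_mul, mul_self_sqrt hc.le]
      have hc0 : (c : ℂ) ≠ 0 := by exact_mod_cast hc.ne'
      simp only [e, EuclideanSpace.inner_toLp_toLp, star_smul, dotProduct_smul,
        dotProduct_comm _ (star (u f)), hu f hf g hg, Subtype.mk.injEq]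
      split_ifs
      · simp only [smul_eq_mul, star_inv₀, RCLike.star_def, Complex.conj_ofReal]
        rw [← mul_assoc, ← mul_inv, hcc, inv_mul_cancel₀ hc0]
      · simp
    have hb := he.sum_inner_products_le (x := WithLp.toLp 2 v) (s := Finset.univ)
    rw [EuclideanSpace.norm_sq_eq] at hb
    have hterm : ∀ f : G, ‖inner ℂ (e f) (WithLp.toLp 2 v)‖ ^ 2 =
        c⁻¹ * Complex.normSq (star v ⬝ᵥ u f) := fun f => by
      have h1 : v ⬝ᵥ star (u f) = star (star v ⬝ᵥ u f) := by
        rw [star_dotProduct, star_star, dotProduct_comm]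
      simp only [e, EuclideanSpace.inner_toLp_toLp, star_smul, dotProduct_smul, h1]
      rw [norm_smul, norm_star, norm_star, norm_inv, Complex.norm_real, norm_eq_abs,
        abs_of_nonneg (sqrt_nonneg _), mul_pow, inv_pow, sq_sqrt hc.le,
        Complex.normSq_eq_norm_sq]
    simp only [hterm, ← Finset.mul_sum] at hb
    rw [Finset.sum_coe_sort G fun f => Complex.normSq (star v ⬝ᵥ u f)] at hb
    simp only [← Complex.normSq_eq_norm_sq] at hb
    rwa [inv_mul_le_iff₀ hc] at hb

lemma sum_normSq_applyRightVec [DecidableEq ι] {L : J → Matrix κ ι ℂ}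
    (hL : ∑ j, (L j)ᴴ * L j = 1) (u : α × ι → ℂ) :
    ∑ j, ∑ v, Complex.normSq (applyRightVec (L j) u v) = ∑ v, Complex.normSq (u v) := by
  have key : ∑ j, star (applyRightVec (L j) u) ⬝ᵥ applyRightVec (L j) u = star u ⬝ᵥ u := by
    have h1 : ∀ j, star (applyRightVec (L j) u) ⬝ᵥ applyRightVec (L j) u =
        star u ⬝ᵥ applyRightVec ((L j)ᴴ * L j) u := fun j => by
      have := star_dotProduct_applyRightVec (L j)ᴴ u (applyRightVec (L j) u)
      rw [conjTranspose_conjTranspose] at this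
      rw [← this]
      congr 1
      ext ⟨a, x⟩
      simp only [applyRightVec, mul_apply, Finset.mul_sum, Finset.sum_mul]
      rw [Finset.sum_comm]
      exact Finset.sum_congr rfl fun _ _ => Finset.sum_congr rfl fun _ _ => by ring
    simp only [h1]
    rw [← dotProduct_sum]
    congr 1
    ext ⟨a, x⟩
    simp only [Finset.sum_apply, applyRightVec]
    rw [Finset.sum_comm]
    simp only [← Finset.sum_mul, ← Matrix.sum_apply, hL, Matrix.one_apply]
    simp
  simp only [star_dotProduct_self_eq] at key
  exact_mod_cast key

/-- Cauchy–Schwarz with a unit `φ`, then trace preservation: fidelity never exceeds the weight of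
the input. -/
lemma fidelity_sum_le_normSq [DecidableEq κ] {S : Type*} [Fintype S] {L : J → Matrix S κ ℂ}
    (hL : ∑ j, (L j)ᴴ * L j = 1) {φ : α × S → ℂ} (hφ : star φ ⬝ᵥ φ = 1) (u : α × κ → ℂ) :
    ∑ j, Complex.normSq (star φ ⬝ᵥ applyRightVec (L j) u) ≤ ∑ v, Complex.normSq (u v) := by
  rw [star_dotProduct_self_eq] at hφ
  have hφ' : ∑ i, Complex.normSq (φ i) = 1 := by exact_mod_cast hφ
  rw [← sum_normSq_applyRightVec hL u]
  refine Finset.sum_le_sum fun j _ => ?_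
  simpa [hφ'] using normSq_star_dotProduct_le φ (applyRightVec (L j) u)

/-- A receiver whose system is confined to a subspace of dimension `#P` cannot reach a fidelity
larger than `c * #P / m`, where `c` bounds the operator norm of the joint state. -/
lemma fidelity_sum_le_card [DecidableEq R] [DecidableEq κ] {m : ℕ} {L : J → Matrix (Fin m) κ ℂ}
    (hL : ∑ j, (L j)ᴴ * L j = 1) {φ : α × Fin m → ℂ}
    (hφ : traceLeft (ketbra φ) = (m : ℂ)⁻¹ • (1 : Matrix (Fin m) (Fin m) ℂ))
    (u : R → α × κ → ℂ) (G : Finset R) {c : ℝ} (hc : 0 ≤ c)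
    (hu : ∀ f ∈ G, ∀ g ∈ G, star (u f) ⬝ᵥ u g = if f = g then (c : ℂ) else 0)
    (P : Finset κ) (hP : ∀ f ∈ G, ∀ a, ∀ y ∉ P, u f (a, y) = 0) :
    ∑ f ∈ G, ∑ j, Complex.normSq (star φ ⬝ᵥ applyRightVec (L j) (u f)) ≤
      c * ((P.card : ℝ) / m) := by
  -- Pull `φ` back through the decoder and cut it to `P`; overlaps with the `u f` do not change, as
  -- these vanish off `P`.
  let w : J → α × κ → ℂ := fun j v => if v.2 ∈ P then applyRightVec (L j)ᴴ φ v else 0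
  have hw : ∀ f ∈ G, ∀ j, star φ ⬝ᵥ applyRightVec (L j) (u f) = star (w j) ⬝ᵥ u f := by
    intro f hf j
    rw [star_dotProduct_applyRightVec]
    refine Finset.sum_congr rfl fun v _ => ?_
    by_cases hv : v.2 ∈ P
    · simp [w, hv]
    · rw [show u f v = 0 from hP f hf v.1 v.2 hv, mul_zero, mul_zero]
  -- Each output basis vector receives pulled-back weight `1/m`: the marginal of `φ` is `1/m`, and
  -- the diagonal entries of `(L j)ᴴ * L j` at `y` sum to one.
  have hterm : ∀ y, ∑ j, ∑ a, Complex.normSq (applyRightVec (L j)ᴴ φ (a, y)) = (m : ℝ)⁻¹ := by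
    intro y
    have h1 : ∀ j, ∑ a, (Complex.normSq (applyRightVec (L j)ᴴ φ (a, y)) : ℂ) =
        (m : ℂ)⁻¹ * ((L j)ᴴ * L j) y y := fun j => by
      have := sum_star_applyRightVec_mul hφ (L j)ᴴ (L j)ᴴ y
      rw [mul_apply]
      simp only [conjTranspose_apply, star_star] at this ⊢
      rw [Finset.sum_congr rfl fun x _ => mul_comm (star (L j x y)) _, ← this]
      exact Finset.sum_congr rfl fun a _ => by
        rw [mul_comm (star _), RCLike.star_def, Complex.mul_conj]
    have h2 : ∑ j, ∑ a, (Complex.normSq (applyRightVec (L j)ᴴ φ (a, y)) : ℂ) = (m : ℂ)⁻¹ := by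
      simp only [h1]
      rw [← Finset.mul_sum, ← Matrix.sum_apply, hL, one_apply_eq, mul_one]
    exact Complex.ofReal_injective (by simpa using h2)
  have hsum : ∑ j, ∑ v, Complex.normSq (w j v) = (P.card : ℝ) / m := by
    simp only [Fintype.sum_prod_type_right]
    rw [Finset.sum_comm]
    have : ∀ y, ∑ j, ∑ a, Complex.normSq (w j (a, y)) = if y ∈ P then (m : ℝ)⁻¹ else 0 := by
      intro y
      by_cases hy : y ∈ P
      · simp only [w, hy, if_true]
        exact hterm y
      · simp [w, hy]
    simp only [this]
    rw [Finset.sum_ite_mem, Finset.univ_inter, Finset.sum_const, nsmul_eq_mul, div_eq_mul_inv]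
  rw [Finset.sum_comm, ← hsum, Finset.mul_sum]
  refine Finset.sum_le_sum fun j _ => ?_
  rw [Finset.sum_congr rfl fun f hf => by rw [hw f hf j]]
  exact sum_normSq_star_dotProduct_le u G hc hu (w j)

end ErasureFidelity

/-! ### Kraus strings grouped by transmitted set -/

section ErasurePower

open Matrix Real

lemma traceLeft_ketbra_of_orthonormal {α β : Type*} [Fintype α] [Fintype β] [DecidableEq β] {r : ℕ}
    (hr : r = Fintype.card β) {e : Fin r → EuclideanSpace ℂ α}
    {f : Fin r → EuclideanSpace ℂ β} (he : Orthonormal ℂ e) (hf : Orthonormal ℂ f) :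
    traceLeft (ketbra fun u : α × β => ((√r : ℂ))⁻¹ * ∑ i, e i u.1 * f i u.2) =
      (r : ℂ)⁻¹ • 1 := by
  have hF : (of fun b i => f i b : Matrix β (Fin r) ℂ)ᴴ * (of fun b i => f i b) = 1 := by
    ext i j
    have := orthonormal_iff_ite.1 hf i j
    rw [PiLp.inner_apply] at this
    simp only [RCLike.inner_apply] at this
    rw [mul_apply, Matrix.one_apply, ← this]
    exact Finset.sum_congr rfl fun b _ => mul_comm _ _
  -- Full Schmidt rank enters here: orthonormality of `f` upgrades to completeness.
  have hF' := (mul_eq_one_comm_of_card_eq _ _ _ (by rw [Fintype.card_fin, hr])).1 hF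
  have hE : ∀ i j, ∑ a, e i a * star (e j a) = if i = j then (1 : ℂ) else 0 := fun i j => by
    have := orthonormal_iff_ite.1 he j i
    rw [PiLp.inner_apply] at this
    simp only [RCLike.inner_apply] at this
    simpa [eq_comm] using this
  have hrr : (√r : ℂ)⁻¹ * (√r : ℂ)⁻¹ = (r : ℂ)⁻¹ := by
    rw [← mul_inv, ← Complex.ofReal_mul, mul_self_sqrt (Nat.cast_nonneg _), Complex.ofReal_natCast]
  ext b b'
  have hb := congrFun (congrFun hF' b) b'
  rw [mul_apply] at hb
  simp only [of_apply, conjTranspose_apply] at hb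
  simp only [traceLeft, ketbra, vecMulVec_apply, of_apply, Pi.star_apply, star_mul', star_inv₀,
    RCLike.star_def, Complex.conj_ofReal, map_sum]
  calc _ = ∑ a, (r : ℂ)⁻¹ * ∑ i, ∑ j, (e i a * star (e j a)) * (f i b * star (f j b')) := by
        refine Finset.sum_congr rfl fun a _ => ?_
        rw [mul_mul_mul_comm, hrr, Finset.sum_mul_sum]
        congr 1
        refine Finset.sum_congr rfl fun i _ => Finset.sum_congr rfl fun j _ => ?_
        rw [map_mul, RCLike.star_def]
        ring
    _ = (r : ℂ)⁻¹ * ∑ i, ∑ j, (∑ a, e i a * star (e j a)) * (f i b * star (f j b')) := by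
        rw [← Finset.mul_sum, Finset.sum_comm]
        congr 1
        refine Finset.sum_congr rfl fun i _ => ?_
        rw [Finset.sum_comm]
        exact Finset.sum_congr rfl fun j _ => by rw [Finset.sum_mul]
    _ = (r : ℂ)⁻¹ * ∑ i, f i b * star (f i b') := by
        simp only [hE, ite_mul, one_mul, zero_mul, Finset.sum_ite_eq, Finset.mem_univ, if_true]
    _ = _ := by rw [hb]; rfl

/-- The squared Hilbert–Schmidt norms of the Kraus operators of the erasure channel. -/
noncomputable def erasureWeight (d : ℕ) (p : ℝ) : Option (Fin d) → ℝ
  | none => (1 - p) * d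
  | some _ => p

/-- Distinct Kraus operators have disjoint sets of nonzero entries. -/
lemma erasureKraus_orthogonal (d : ℕ) {p : ℝ} (hp0 : 0 ≤ p) (hp1 : p ≤ 1)
    (r s : Option (Fin d)) :
    ∑ y, ∑ x, star (erasureKraus d p r y x) * erasureKraus d p s y x =
      if r = s then (erasureWeight d p r : ℂ) else 0 := by
  have h1 : (√(1 - p) : ℂ) * √(1 - p) = ((1 - p : ℝ) : ℂ) := by
    rw [← Complex.ofReal_mul, mul_self_sqrt (by linarith)]
  have h2 : (√p : ℂ) * √p = p := by
    rw [← Complex.ofReal_mul, mul_self_sqrt hp0]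
  rw [Complex.ofReal_sub, Complex.ofReal_one] at h1
  rcases r with _ | i <;> rcases s with _ | j <;>
    simp [Fintype.sum_option, erasureKraus, erasureWeight, apply_ite (starRingEnd ℂ), h1, h2,
      mul_comm]
  · ring
  · simp only [eq_comm]

lemma tensorPowKraus_orthogonal (d : ℕ) {p : ℝ} (hp0 : 0 ≤ p) (hp1 : p ≤ 1) (n : ℕ)
    (f g : Fin n → Option (Fin d)) :
    ∑ y, ∑ x, star (tensorPowKraus (erasureKraus d p) n f y x) *
        tensorPowKraus (erasureKraus d p) n g y x =
      if f = g then ((∏ k, erasureWeight d p (f k) : ℝ) : ℂ) else 0 := by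
  have h : ∏ k, ∑ y, ∑ x, star (erasureKraus d p (f k) y x) * erasureKraus d p (g k) y x =
      ∑ y, ∑ x, star (tensorPowKraus (erasureKraus d p) n f y x) *
        tensorPowKraus (erasureKraus d p) n g y x := by
    rw [Fintype.prod_sum]
    refine Finset.sum_congr rfl fun y _ => ?_
    rw [Fintype.prod_sum]
    refine Finset.sum_congr rfl fun x _ => ?_
    simp only [tensorPowKraus, of_apply, star_prod, Finset.prod_mul_distrib]
  rw [← h]
  simp only [erasureKraus_orthogonal d hp0 hp1]
  split_ifs with hfg
  · subst hfg
    simp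
  · obtain ⟨k, hk⟩ := Function.ne_iff.1 hfg
    exact Finset.prod_eq_zero (Finset.mem_univ k) (by simp [hk])

/-- The uses of the channel in which the input is transmitted. -/
def transmitted {d n : ℕ} (f : Fin n → Option (Fin d)) : Finset (Fin n) :=
  Finset.univ.filter fun k => f k = none

lemma prod_ite_mem_eq_pow {M : Type*} [CommMonoid M] {n : ℕ} (S : Finset (Fin n)) (a b : M) :
    ∏ k, (if k ∈ S then a else b) = a ^ S.card * b ^ (n - S.card) := by
  rw [Finset.prod_ite, Finset.prod_const, Finset.prod_const, Finset.filter_not]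
  simp [Finset.card_sdiff]

lemma card_transmitted_eq {d n : ℕ} (S : Finset (Fin n)) :
    (Finset.univ.filter fun f : Fin n → Option (Fin d) => transmitted f = S).card =
      d ^ (n - S.card) := by
  have h : (Finset.univ.filter fun f : Fin n → Option (Fin d) => transmitted f = S) =
      Fintype.piFinset fun k => if k ∈ S then {none} else Finset.univ.erase none := by
    ext f
    simp only [transmitted, Finset.mem_filter, Finset.mem_univ, true_and, Finset.ext_iff,
      Fintype.mem_piFinset]
    refine forall_congr' fun k => ?_
    by_cases hk : k ∈ S <;> simp [hk]
  rw [h, Fintype.card_piFinset]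
  simp only [apply_ite Finset.card, Finset.card_singleton, Finset.card_erase_of_mem,
    Finset.mem_univ, Finset.card_univ, Fintype.card_option, Fintype.card_fin,
    Nat.add_sub_cancel]
  rw [prod_ite_mem_eq_pow, one_pow, one_mul]

/-- The basis vectors of the outputs in which exactly the uses in `S` are not erased. -/
def outputSupport (d : ℕ) {n : ℕ} (S : Finset (Fin n)) : Finset (Fin n → Option (Fin d)) :=
  Fintype.piFinset fun k => if k ∈ S then Finset.univ.erase none else {none}

lemma card_outputSupport (d : ℕ) {n : ℕ} (S : Finset (Fin n)) :
    (outputSupport d S).card = d ^ S.card := by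
  rw [outputSupport, Fintype.card_piFinset]
  simp only [apply_ite Finset.card, Finset.card_singleton, Finset.card_erase_of_mem,
    Finset.mem_univ, Finset.card_univ, Fintype.card_option, Fintype.card_fin,
    Nat.add_sub_cancel]
  rw [prod_ite_mem_eq_pow, one_pow, mul_one]

lemma tensorPowKraus_eq_zero {d n : ℕ} (p : ℝ) (f : Fin n → Option (Fin d))
    {y : Fin n → Option (Fin d)} (hy : y ∉ outputSupport d (transmitted f)) (x : Fin n → Fin d) :
    tensorPowKraus (erasureKraus d p) n f y x = 0 := by
  rw [outputSupport, Fintype.mem_piFinset, not_forall] at hy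
  obtain ⟨k, hk⟩ := hy
  refine Finset.prod_eq_zero (Finset.mem_univ k) ?_
  rcases hf : f k with _ | i
  · have : k ∈ transmitted f := by simp [transmitted, hf]
    simp only [this, if_true, Finset.mem_erase, Finset.mem_univ, and_true, not_not] at hk
    simp [erasureKraus, hk]
  · have : k ∉ transmitted f := by simp [transmitted, hf]
    simp only [this, if_false, Finset.mem_singleton] at hk
    simp [erasureKraus, hk]

lemma prod_erasureWeight {d n : ℕ} (p : ℝ) (f : Fin n → Option (Fin d)) :
    ∏ k, erasureWeight d p (f k) =
      ((1 - p) * d) ^ (transmitted f).card * p ^ (n - (transmitted f).card) := by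
  rw [← prod_ite_mem_eq_pow]
  refine Finset.prod_congr rfl fun k _ => ?_
  rcases hf : f k with _ | i <;> simp [transmitted, hf, erasureWeight]

/-- The fidelity contributed by the erasure patterns with transmitted set `S` is at most the
probability of `S`, and at most this probability times `d ^ #S / d ^ (n - #S) / m`. -/
lemma fidelity_transmitted_le {α J : Type*} [Fintype α] [Fintype J] {d : ℕ} (hd : 1 ≤ d) {p : ℝ}
    (hp0 : 0 ≤ p) (hp1 : p ≤ 1) {n m : ℕ} {L : J → Matrix (Fin m) (Fin n → Option (Fin d)) ℂ}
    (hL : ∑ j, (L j)ᴴ * L j = 1) {φ : α × Fin m → ℂ} (hφ : IsInformationState φ)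
    {ψ : α × (Fin n → Fin d) → ℂ} (hψ : traceLeft (ketbra ψ) = ((d ^ n : ℕ) : ℂ)⁻¹ • 1)
    (S : Finset (Fin n)) :
    ∑ f : Fin n → Option (Fin d) with transmitted f = S, ∑ j, Complex.normSq
        (star φ ⬝ᵥ applyRightVec (L j) (applyRightVec (tensorPowKraus (erasureKraus d p) n f) ψ)) ≤
      (1 - p) ^ S.card * p ^ (n - S.card) *
        min 1 ((d : ℝ) ^ S.card / (d : ℝ) ^ (n - S.card) / m) := by
  set u : (Fin n → Option (Fin d)) → α × (Fin n → Option (Fin d)) → ℂ := fun f =>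
    applyRightVec (tensorPowKraus (erasureKraus d p) n f) ψ with hu
  set q := (1 - p) ^ S.card * p ^ (n - S.card) with hq
  have hd0 : (d : ℝ) ≠ 0 := by exact_mod_cast (by omega : d ≠ 0)
  have hq0 : 0 ≤ q := mul_nonneg (pow_nonneg (by linarith) _) (pow_nonneg hp0 _)
  have hS : S.card ≤ n := by simpa using Finset.card_le_univ S
  -- The common squared length: `q` divided among the `d ^ (n - #S)` strings with transmitted set
  -- `S`.
  set c : ℝ := q / (d : ℝ) ^ (n - S.card) with hc
  have hc0 : 0 ≤ c := div_nonneg hq0 (by positivity)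
  have horth : ∀ f, transmitted f = S → ∀ g,
      star (u f) ⬝ᵥ u g = if f = g then (c : ℂ) else 0 := fun f hf g => by
    rw [hu, star_applyRightVec_dotProduct hψ, tensorPowKraus_orthogonal d hp0 hp1,
      prod_erasureWeight, hf]
    split_ifs
    · rw [hc, hq, ← Complex.ofReal_natCast, ← Complex.ofReal_inv, ← Complex.ofReal_mul]
      congr 1
      have : ((d ^ n : ℕ) : ℝ) = (d : ℝ) ^ S.card * (d : ℝ) ^ (n - S.card) := by
        rw [← pow_add, Nat.add_sub_cancel' hS, Nat.cast_pow]
      rw [this, mul_pow]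
      field_simp
    · rw [mul_zero]
  have hmem : ∀ f, f ∈ (Finset.univ.filter fun f : Fin n → Option (Fin d) => transmitted f = S) →
      transmitted f = S := fun f hf => (Finset.mem_filter.1 hf).2
  rw [mul_min_of_nonneg _ _ hq0]
  refine le_min ?_ ?_
  · calc _ ≤ ∑ f : Fin n → Option (Fin d) with transmitted f = S, c := by
          refine Finset.sum_le_sum fun f hf => (fidelity_sum_le_normSq hL hφ.1 (u f)).trans_eq ?_
          have h := horth f (hmem f hf) f
          rw [star_dotProduct_self_eq, if_pos rfl] at h
          exact_mod_cast h
      _ = q * 1 := by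
          rw [Finset.sum_const, card_transmitted_eq, nsmul_eq_mul, hc, Nat.cast_pow]
          field_simp
  · refine (fidelity_sum_le_card hL hφ.2 u _ hc0 (fun f hf g _ => horth f (hmem f hf) g)
      (outputSupport d S) fun f hf a y hy => ?_).trans_eq ?_
    · refine Finset.sum_eq_zero fun x _ => ?_
      rw [tensorPowKraus_eq_zero p f (by rwa [hmem f hf]), zero_mul]
    · rw [card_outputSupport, hc, Nat.cast_pow]
      ring

/-! ### The exponential bound and its exponent near zero -/

/-- For an exponent `-s` in `[0, 1]`, the power `t ^ (-s)` lies between `1` and `t`. -/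
lemma min_one_le_rpow {t s : ℝ} (ht : 0 < t) (hs : s ≤ 0) (hs1 : -1 ≤ s) :
    min 1 t ≤ t ^ (-s) := by
  rcases le_total t 1 with h | h
  · rw [min_eq_right h]
    simpa using rpow_le_rpow_of_exponent_ge ht h (show -s ≤ 1 by linarith)
  · rw [min_eq_left h]
    exact one_le_rpow h (by linarith)

lemma erasureE0_base_pos {d : ℕ} (hd : 1 ≤ d) {p : ℝ} (hp0 : 0 ≤ p) (hp1 : p ≤ 1) (s : ℝ) :
    0 < (1 - p) * (d : ℝ) ^ (-s) + p * (d : ℝ) ^ s := by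
  have hd0 : (0 : ℝ) < d := by exact_mod_cast hd
  have h1 := rpow_pos_of_pos hd0 (-s)
  have h2 := rpow_pos_of_pos hd0 s
  rcases hp0.eq_or_lt with rfl | hp
  · simpa using h1
  · have := mul_nonneg (sub_nonneg.2 hp1) h1.le
    have := mul_pos hp h2
    linarith

lemma exp_bound_eq {d : ℕ} (hd : 1 ≤ d) {p : ℝ} (hp0 : 0 ≤ p) (hp1 : p ≤ 1) (s : ℝ) {n m : ℕ}
    (hn : 1 ≤ n) (hm : 0 < m) :
    exp (n * (s * commRate n m - erasureE0 d p s)) =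
      (m : ℝ) ^ s * ((1 - p) * (d : ℝ) ^ (-s) + p * (d : ℝ) ^ s) ^ n := by
  have hn0 : (n : ℝ) ≠ 0 := by exact_mod_cast (by omega : n ≠ 0)
  have hb := erasureE0_base_pos hd hp0 hp1 s
  rw [commRate, erasureE0, sub_neg_eq_add, mul_add, exp_add,
    rpow_def_of_pos (show (0 : ℝ) < m by exact_mod_cast hm)]
  congr 1
  · congr 1
    field_simp
  · rw [exp_nat_mul, exp_log hb]

lemma IsInformationState.pos {α : Type*} [Fintype α] {m : ℕ} {φ : α × Fin m → ℂ}
    (hφ : IsInformationState φ) : 0 < m := by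
  rcases Nat.eq_zero_or_pos m with rfl | h
  · have := hφ.1
    simp [dotProduct] at this
  · exact h

/-- The exponential bound on the fidelity, for all `s` in `[-1, 0]`. -/
lemma pureFidelity_decodedState_le {a d : ℕ} (hd : 1 ≤ d) {p : ℝ} (hp0 : 0 ≤ p) (hp1 : p ≤ 1)
    {s : ℝ} (hs1 : -1 ≤ s) (hs : s ≤ 0) {n m : ℕ} (hn : 1 ≤ n) {φ : Fin a × Fin m → ℂ}
    (hφ : IsInformationState φ)
    {T : Matrix (Fin n → Option (Fin d)) (Fin n → Option (Fin d)) ℂ → Matrix (Fin m) (Fin m) ℂ}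
    (hT : IsChannel T) {ρ : Matrix (Fin a × (Fin n → Fin d)) (Fin a × (Fin n → Fin d)) ℂ}
    (hρ : IsMaxEntangled (d ^ n) ρ) :
    pureFidelity φ (decodedState d p n m T ρ) ≤
      exp (n * (s * commRate n m - erasureE0 d p s)) := by
  obtain ⟨J, L, hL, rfl⟩ := hT
  obtain ⟨-, e, f, he, hf, rfl⟩ := hρ
  have hψ := traceLeft_ketbra_of_orthonormal (by simp) he hf
  have hm := hφ.pos
  have hm0 : (0 : ℝ) < m := by exact_mod_cast hm
  have hd0 : (0 : ℝ) < d := by exact_mod_cast hd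
  rw [exp_bound_eq hd hp0 hp1 s hn hm, decodedState, erasureChannelPow,
    pureFidelity_applyRight_krausMap, ← Finset.sum_fiberwise Finset.univ transmitted]
  refine (Finset.sum_le_sum fun S _ =>
    fidelity_transmitted_le hd hp0 hp1 hL hφ hψ S).trans ?_
  have hterm : ∀ S : Finset (Fin n), (1 - p) ^ S.card * p ^ (n - S.card) *
      min 1 ((d : ℝ) ^ S.card / (d : ℝ) ^ (n - S.card) / m) ≤
        (m : ℝ) ^ s * (((1 - p) * (d : ℝ) ^ (-s)) ^ S.card *
          (p * (d : ℝ) ^ s) ^ (Fintype.card (Fin n) - S.card)) := fun S => by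
    have hq0 : 0 ≤ (1 - p) ^ S.card * p ^ (n - S.card) :=
      mul_nonneg (pow_nonneg (by linarith) _) (pow_nonneg hp0 _)
    refine (mul_le_mul_of_nonneg_left (min_one_le_rpow (by positivity) hs hs1) hq0).trans_eq ?_
    rw [Fintype.card_fin, div_rpow (by positivity) hm0.le, div_rpow (by positivity) (by positivity),
      rpow_neg hm0.le, div_inv_eq_mul, mul_comm _ ((m : ℝ) ^ s), mul_left_comm,
      ← rpow_pow_comm hd0.le, ← rpow_pow_comm hd0.le, mul_pow,
      mul_pow, rpow_neg hd0.le, inv_pow, inv_pow, div_inv_eq_mul]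
    ring
  refine (Finset.sum_le_sum fun S _ => hterm S).trans_eq ?_
  -- Binomial theorem as a sum over subsets.
  rw [← Finset.mul_sum, Fintype.sum_pow_mul_eq_add_pow, Fintype.card_fin]

lemma hasDerivAt_mul_sub_erasureE0 {d : ℕ} (hd : 1 ≤ d) {p : ℝ} (hp0 : 0 ≤ p) (hp1 : p ≤ 1)
    (R : ℝ) :
    HasDerivAt (fun s => s * R - erasureE0 d p s) (R - (1 - 2 * p) * log d) 0 := by
  have hd0 : (0 : ℝ) < d := by exact_mod_cast hd
  have h1 : HasDerivAt (fun s : ℝ => (d : ℝ) ^ s) (log d) 0 := by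
    simpa using (hasStrictDerivAt_const_rpow hd0 0).hasDerivAt
  have h2 : HasDerivAt (fun s : ℝ => (d : ℝ) ^ (-s)) (-log d) 0 := by
    have h1' : HasDerivAt (fun s : ℝ => (d : ℝ) ^ s) (log d) (-0) := by rwa [neg_zero]
    exact (h1'.comp (0 : ℝ) (hasDerivAt_neg 0)).congr_deriv (by simp)
  have h3 := ((h2.const_mul (1 - p)).add (h1.const_mul p)).log
    (erasureE0_base_pos hd hp0 hp1 0).ne'
  have h4 := ((hasDerivAt_id (0 : ℝ)).mul_const R).sub h3.neg
  refine h4.congr_deriv ?_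
  simp
  ring

/-- At rates above the coherent information the exponent becomes negative for some `s`. -/
lemma exists_mul_sub_erasureE0_neg {d : ℕ} (hd : 1 ≤ d) {p : ℝ} (hp0 : 0 ≤ p) (hp1 : p ≤ 1)
    {R : ℝ} (hR : (1 - 2 * p) * log d < R) :
    ∃ s : ℝ, -(1 / 2) ≤ s ∧ s < 0 ∧ s * R - erasureE0 d p s < 0 := by
  have h := (hasDerivAt_mul_sub_erasureE0 hd hp0 hp1 R)
  have h0 : (0 : ℝ) * R - erasureE0 d p 0 = 0 := by simp [erasureE0]
  have hsl := (hasDerivAt_iff_tendsto_slope.1 h).eventually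
    (lt_mem_nhds (show 0 < R - (1 - 2 * p) * log d by linarith))
  -- To the left of zero a positive slope means a negative value, since the denominator `s` is
  -- negative.
  have hsl' := hsl.filter_mono (nhdsWithin_mono 0 (s := Set.Iio (0 : ℝ)) fun x hx => ne_of_lt hx)
  have hnear : ∀ᶠ s in nhdsWithin (0 : ℝ) (Set.Iio 0), s ∈ Set.Ioo (-(1 / 2) : ℝ) 0 :=
    Ioo_mem_nhdsLT (by norm_num)
  obtain ⟨s, hs, hs2⟩ := (hsl'.and hnear).exists
  refine ⟨s, hs2.1.le, hs2.2, ?_⟩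
  rw [slope_def_field, h0, sub_zero, sub_zero] at hs
  by_contra hcon
  exact absurd hs (not_lt.2 (div_nonpos_of_nonneg_of_nonpos (not_lt.1 hcon) hs2.2.le))

end ErasurePower

/-- Strong converse for the quantum erasure channel with maximally entangled inputs of full
Schmidt rank. In the second and third groups, the first half allows every maximally entangled
channel input `ρ`, also with a Schmidt rank other than that of `φ`; the second half is the
case of inputs `ρ = (id ⊗ E)(|φ⟩⟨φ|)` produced by an encoder `E`. -/
theorem theorem3 (d : ℕ) (hd : 1 ≤ d) (p : ℝ) (hp0 : 0 ≤ p) (hp1 : p ≤ 1) :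
    -- the coherent information of the channel
    (IsGreatest (coherentInfoValues (erasureChannel d p))
        (channelCoherentInfo (erasureChannel d p)) ∧
      channelCoherentInfo (erasureChannel d p) = max 0 (1 - 2 * p) * Real.log d) ∧
    -- the exponential bound on the fidelity
    (∀ s : ℝ, -(1 / 2) ≤ s → s < 0 → ∀ n a m : ℕ, 1 ≤ n →
      ∀ φ : Fin a × Fin m → ℂ, IsInformationState φ →
      ∀ T : Matrix (Fin n → Option (Fin d)) (Fin n → Option (Fin d)) ℂ →
          Matrix (Fin m) (Fin m) ℂ, IsChannel T →
        (∀ ρ : Matrix (Fin a × (Fin n → Fin d)) (Fin a × (Fin n → Fin d)) ℂ,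
          IsMaxEntangled (d ^ n) ρ →
          pureFidelity φ (decodedState d p n m T ρ) ≤
            Real.exp (n * (s * commRate n m - erasureE0 d p s))) ∧
        (∀ E : Matrix (Fin m) (Fin m) ℂ → Matrix (Fin n → Fin d) (Fin n → Fin d) ℂ,
          IsChannel E → IsMaxEntangled (d ^ n) (applyRight E (ketbra φ)) →
          pureFidelity φ (decodedState d p n m T (applyRight E (ketbra φ))) ≤
            Real.exp (n * (s * commRate n m - erasureE0 d p s)))) ∧
    -- exponential decay at all rates above the coherent information
    (∀ R : ℝ, channelCoherentInfo (erasureChannel d p) < R → ∃ c : ℝ, 0 < c ∧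
      ∀ n a m : ℕ, 1 ≤ n → R ≤ commRate n m →
      ∀ φ : Fin a × Fin m → ℂ, IsInformationState φ →
      ∀ T : Matrix (Fin n → Option (Fin d)) (Fin n → Option (Fin d)) ℂ →
          Matrix (Fin m) (Fin m) ℂ, IsChannel T →
        (∀ ρ : Matrix (Fin a × (Fin n → Fin d)) (Fin a × (Fin n → Fin d)) ℂ,
          IsMaxEntangled (d ^ n) ρ →
          pureFidelity φ (decodedState d p n m T ρ) ≤ Real.exp (-(c * n))) ∧
        (∀ E : Matrix (Fin m) (Fin m) ℂ → Matrix (Fin n → Fin d) (Fin n → Fin d) ℂ,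
          IsChannel E → IsMaxEntangled (d ^ n) (applyRight E (ketbra φ)) →
          pureFidelity φ (decodedState d p n m T (applyRight E (ketbra φ))) ≤
            Real.exp (-(c * n)))) := by
  have hQ := isGreatest_coherentInfoValues_erasureChannel hd hp0 hp1
  have hQ' : channelCoherentInfo (erasureChannel d p) = max 0 (1 - 2 * p) * Real.log d :=
    hQ.csSup_eq
  refine ⟨⟨by rw [hQ']; exact hQ, hQ'⟩, ?_, ?_⟩
  · intro s hs1 hs n a m hn φ hφ T hT
    have key := fun ρ (hρ : IsMaxEntangled (d ^ n) ρ) =>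
      pureFidelity_decodedState_le hd hp0 hp1 (by linarith : -1 ≤ s) hs.le hn hφ hT hρ
    exact ⟨key, fun E _ hE => key _ hE⟩
  · intro R hR
    have hlog : 0 ≤ Real.log d := Real.log_natCast_nonneg d
    -- Only the unclipped `1 - 2p` matters for the slope; the clipped value dominates it because
    -- `log d ≥ 0`.
    have hR' : (1 - 2 * p) * Real.log d < R :=
      (mul_le_mul_of_nonneg_right (le_max_right _ _) hlog).trans_lt (hQ' ▸ hR)
    obtain ⟨s, hs1, hs, hneg⟩ := exists_mul_sub_erasureE0_neg hd hp0 hp1 hR'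
    refine ⟨-(s * R - erasureE0 d p s), by linarith, ?_⟩
    intro n a m hn hrate φ hφ T hT
    have key : ∀ ρ, IsMaxEntangled (d ^ n) ρ → pureFidelity φ (decodedState d p n m T ρ) ≤
        Real.exp (-(-(s * R - erasureE0 d p s) * n)) := fun ρ hρ => by
      refine (pureFidelity_decodedState_le hd hp0 hp1 (by linarith : -1 ≤ s) hs.le hn hφ hT
        hρ).trans (Real.exp_le_exp.2 ?_)
      -- As `s < 0`, a rate above `R` only lowers the exponent, so `s`, chosen for `R`, serves all
      -- higher rates.
      have h1 := mul_le_mul_of_nonpos_left hrate hs.le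
      have h2 := mul_le_mul_of_nonneg_left h1 (Nat.cast_nonneg (α := ℝ) n)
      linarith
    exact ⟨key, fun E _ hE => key _ hE⟩
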